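/- Let $k\ge 2$ and let $H$ be a finite $k$-uniform hypergraph (a set $E(H)$ of $k$-element subsets of a vertex set identified with $[n]=\{1,\dots,n\}$), and let $d_1,\dots,d_n$ be its vertex degrees. Let $\mathcal A_H$ be the order $k$, dimension $n$ adjacency tensor, with entry $\frac{1}{(k-1)!}$ at $(i_1,\dots,i_k)$ if $\{i_1,\dots,i_k\}\in E(H)$ and $0$ otherwise; let $\mathcal D_H$ be the order $k$ diagonal tensor with diagonal entries $d_1,\dots,d_n$; and let $\mathcal L_H=\mathcal D_H-\mathcal A_H$ and $\mathcal Q_H=\mathcal D_H+\mathcal A_H$. For an order $k$, dimension $n$ complex tensor $\mathcal T=(t_{i_1\cdots i_k})$ and $d\ge 1$, the $d$-th order trace is $$\mathrm{Tr}_d(\mathcal T)=(k-1)^{n-1}\sum_{\substack{m_1+\cdots+m_n=d\\ m_i\ge 0}}\ \prod_{i=1}^n\frac{1}{(m_i(k-1))!}\Big(\sum_{y\in[n]^{k-1}}t_{iy}\frac{\partial}{\partial a_{iy}}\Big)^{m_i}\operatorname{tr}\big(A^{d(k-1)}\big),$$ where $A=(a_{ij})$ is an $n\times n$ matrix of independent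 variables and $\frac{\partial}{\partial a_{iy}}=\frac{\partial}{\partial a_{ii_2}}\cdots\frac{\partial}{\partial a_{ii_k}}$ for $y=(i_2,\dots,i_k)$. Then $$\mathrm{Tr}_t(\mathcal L_H)=\mathrm{Tr}_t(\mathcal Q_H)=(k-1)^{n-1}\sum_{i=1}^n d_i^t\qquad (t=1,\dots,k-1),$$ $$\mathrm{Tr}_k(\mathcal L_H)=(-1)^k k^{k-1}(k-1)^{n-k}|E(H)|+(k-1)^{n-1}\sum_{i=1}^n d_i^k,$$ $$\mathrm{Tr}_k(\mathcal Q_H)=k^{k-1}(k-1)^{n-k}|E(H)|+(k-1)^{n-1}\sum_{i=1}^n d_i^k.$$ -/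

import Mathlib

open scoped Nat

noncomputable section

/-- Complex tensors of order `k` with index set `V` (so of dimension `|V|`). The entry
`t_{i i₂ ⋯ i_k}` of `T` is `T i y` with `y = (i₂, …, i_k)`. -/
abbrev Tensor (k : ℕ) (V : Type*) : Type _ := V → (Fin (k - 1) → V) → ℂ

namespace Tensor

variable {k : ℕ} {V : Type*}

/-- `∂/∂a_{iy} = ∂/∂a_{i i₂} ⋯ ∂/∂a_{i i_k}` for `y = (i₂, …, i_k)`, acting on polynomials in the
entries `a_{uv}` of an auxiliary `V × V` matrix. -/
def partialOp (i : V) (y : Fin (k - 1) → V) : Module.End ℂ (MvPolynomial (V × V) ℂ) :=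
  (List.ofFn fun j => ((MvPolynomial.pderiv (i, y j) :
    Derivation ℂ (MvPolynomial (V × V) ℂ) (MvPolynomial (V × V) ℂ)) :
      Module.End ℂ (MvPolynomial (V × V) ℂ))).prod

/-- The differential operator `∑_y t_{iy} ∂/∂a_{iy}`. -/
def rowOp [Fintype V] (T : Tensor k V) (i : V) : Module.End ℂ (MvPolynomial (V × V) ℂ) :=
  ∑ y : Fin (k - 1) → V, T i y • partialOp i y

theorem pderiv_commute {σ : Type*} (a b : σ) :
    Commute
      ((MvPolynomial.pderiv a : Derivation ℂ (MvPolynomial σ ℂ) (MvPolynomial σ ℂ)) :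
        Module.End ℂ (MvPolynomial σ ℂ))
      ((MvPolynomial.pderiv b : Derivation ℂ (MvPolynomial σ ℂ) (MvPolynomial σ ℂ)) :
        Module.End ℂ (MvPolynomial σ ℂ)) := by
  classical
  have h : ⁅(MvPolynomial.pderiv a : Derivation ℂ (MvPolynomial σ ℂ) (MvPolynomial σ ℂ)),
      (MvPolynomial.pderiv b : Derivation ℂ (MvPolynomial σ ℂ) (MvPolynomial σ ℂ))⁆ = 0 := by
    apply MvPolynomial.derivation_ext
    intro i
    simp only [Derivation.commutator_apply, MvPolynomial.pderiv_X, Pi.single_apply]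
    split_ifs <;> simp
  refine LinearMap.ext fun p => ?_
  have hp := congrArg
    (fun D : Derivation ℂ (MvPolynomial σ ℂ) (MvPolynomial σ ℂ) => D p) h
  simp only [Derivation.commutator_apply, Derivation.coe_zero, Pi.zero_apply] at hp
  exact sub_eq_zero.mp hp

theorem rowOp_commute [Fintype V] (T : Tensor k V) (i j : V) :
    Commute (rowOp T i) (rowOp T j) := by
  refine Commute.sum_left _ _ _ fun y _ => Commute.sum_right _ _ _ fun z _ => ?_
  refine (Commute.smul_left ?_ _).smul_right _
  refine Commute.list_prod_left _ _ fun f hf => Commute.list_prod_right _ _ fun g hg => ?_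
  obtain ⟨a, rfl⟩ := List.mem_ofFn' _ _ |>.mp hf
  obtain ⟨b, rfl⟩ := List.mem_ofFn' _ _ |>.mp hg
  exact pderiv_commute _ _

/-- The operator `∏_i (1 / (m_i (k-1))!) (∑_y t_{iy} ∂/∂a_{iy})^{m_i}`; its factors commute. -/
def traceOp [Fintype V] (T : Tensor k V) (m : V → ℕ) :
    Module.End ℂ (MvPolynomial (V × V) ℂ) :=
  Finset.univ.noncommProd (fun i => (1 / ((m i * (k - 1))! : ℂ)) • rowOp T i ^ m i)
    fun i _ j _ _ => (((rowOp_commute T i j).pow_pow _ _).smul_left _).smul_right _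

/-- The `d`-th order trace
`Tr_d(T) = (k-1)^{n-1} ∑_{m_1+⋯+m_n=d} ∏_i (1 / (m_i (k-1))!) (∑_y t_{iy} ∂/∂a_{iy})^{m_i}
tr(A^{d(k-1)})`, where `A = (a_{uv})` is the generic matrix. The operators have order `d(k-1)` and
`tr(A^{d(k-1)})` is homogeneous of the same degree, so what they produce is a constant polynomial,
which `MvPolynomial.constantCoeff` reads off as a complex number. -/
def trace [Fintype V] [DecidableEq V] (d : ℕ) (T : Tensor k V) : ℂ :=
  ((k : ℂ) - 1) ^ ((Fintype.card V : ℤ) - 1) *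
    MvPolynomial.constantCoeff
      (∑ m ∈ Finset.piAntidiag (Finset.univ : Finset V) d,
        traceOp T m (Matrix.trace (Matrix.mvPolynomialX V V ℂ ^ (d * (k - 1)))))

end Tensor

namespace Hypergraph

variable {α : Type*}

/-- Every edge consists of exactly `k` distinct vertices. -/
def IsUniform (H : Hypergraph α) (k : ℕ) : Prop :=
  ∀ e ∈ H.edgeSet, e.Finite ∧ e.ncard = k

/-- The degree of a vertex: the number of edges that contain it. -/
def degree (H : Hypergraph α) (v : α) : ℕ :=
  {e ∈ H.edgeSet | v ∈ e}.ncard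

open Classical in
/-- The adjacency tensor of order `k`: the entry at `(i₁, i₂, …, i_k)` is `1 / (k-1)!` if
`{i₁, i₂, …, i_k}` is an edge and `0` otherwise. -/
def adjTensor (H : Hypergraph α) (k : ℕ) : Tensor k H.vertexSet := fun i y =>
  if insert (i : α) (Set.range fun j => (y j : α)) ∈ H.edgeSet then 1 / ((k - 1)! : ℂ) else 0

open Classical in
/-- The diagonal tensor of order `k` of the vertex degrees. -/
def degTensor (H : Hypergraph α) (k : ℕ) : Tensor k H.vertexSet := fun i y =>
  if ∀ j, y j = i then (H.degree i : ℂ) else 0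

/-- The Laplacian tensor `D - A`. -/
def laplacianTensor (H : Hypergraph α) (k : ℕ) : Tensor k H.vertexSet :=
  H.degTensor k - H.adjTensor k

/-- The signless Laplacian tensor `D + A`. -/
def signlessLaplacianTensor (H : Hypergraph α) (k : ℕ) : Tensor k H.vertexSet :=
  H.degTensor k + H.adjTensor k

end Hypergraph

end

/-! The operator `rowOp T i` is `rowPoly T i` evaluated at the partial derivatives, so each term of
the trace is the apolar pairing of a product of row polynomials with `tr(A^N)`. In this pairing a
monomial `M` picks out `M!` times its coefficient, which counts closed walks using each arc as often
as `M` says.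

For `D + ε A` the row polynomial of `i` is `d_i a_ii^(k-1)` plus `ε ∏_{j ∈ e, j ≠ i} a_ij` for each
edge `e` through `i`: the `(k-1)!` orderings cancel the entry `1/(k-1)!`. Expanding the product puts
loops or the star of an edge into each of `t` slots. Closed walks force in-degree to equal
out-degree, and for `t ≤ k` only two kinds of choice survive (`eq_const_of_balanced`). If every slot
holds loops, they all sit at one vertex `v`, which contributes `d_v^t`. Otherwise `t = k` and the
slots hold the stars of one edge at its `k` vertices, forming a complete digraph.

The closed walks of that digraph are counted by the BEST theorem (`coeff_pow_mul_prod_factorial`),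
with Cayley's number `k^(k-2)` as the determinant. Each edge then contributes `ε^k k^(k-1)
(k-1)^(1-k)`; the cases are `ε = -1` and `ε = 1`. -/

noncomputable section

/-! ### Walk counting in the generic matrix power: the BEST theorem. -/

namespace Walk

open MvPolynomial Finset

variable {V : Type*} [Fintype V]

/-- The number of arcs leaving `v`, with multiplicity. -/
def outdeg (M : V × V →₀ ℕ) (v : V) : ℕ := ∑ j, M (v, j)

/-- The number of arcs entering `v`, with multiplicity. -/
def indeg (M : V × V →₀ ℕ) (v : V) : ℕ := ∑ i, M (i, v)

theorem outdeg_add (M M' : V × V →₀ ℕ) (v : V) : outdeg (M + M') v = outdeg M v + outdeg M' v := by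
  simp [outdeg, sum_add_distrib]

theorem indeg_add (M M' : V × V →₀ ℕ) (v : V) : indeg (M + M') v = indeg M v + indeg M' v := by
  simp [indeg, sum_add_distrib]

theorem outdeg_sum {ι : Type*} (s : Finset ι) (f : ι → V × V →₀ ℕ) (v : V) :
    outdeg (∑ x ∈ s, f x) v = ∑ x ∈ s, outdeg (f x) v := by
  simp only [outdeg, Finsupp.finsetSum_apply]
  exact sum_comm

theorem indeg_sum {ι : Type*} (s : Finset ι) (f : ι → V × V →₀ ℕ) (v : V) :
    indeg (∑ x ∈ s, f x) v = ∑ x ∈ s, indeg (f x) v := by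
  simp only [indeg, Finsupp.finsetSum_apply]
  exact sum_comm

variable [DecidableEq V]

theorem outdeg_single (i j : V) (c : ℕ) (v : V) :
    outdeg (Finsupp.single (i, j) c) v = if v = i then c else 0 := by
  unfold outdeg
  simp only [Finsupp.single_apply, Prod.mk.injEq]
  by_cases h : v = i
  · simp [h]
  · simp [h, Ne.symm h]

theorem indeg_single (i j : V) (c : ℕ) (v : V) :
    indeg (Finsupp.single (i, j) c) v = if v = j then c else 0 := by
  unfold indeg
  simp only [Finsupp.single_apply, Prod.mk.injEq]
  by_cases h : v = j
  · simp [h]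
  · simp [h, Ne.symm h]

/-- The arcs `M` can be those of a walk from `u` to `r`, as far as the degrees are concerned. -/
def Balanced (M : V × V →₀ ℕ) (u r : V) : Prop :=
  ∀ v, outdeg M v + (if v = r then 1 else 0) = indeg M v + (if v = u then 1 else 0)

theorem coeff_pow_zero (M : V × V →₀ ℕ) (u r : V) :
    coeff M ((Matrix.mvPolynomialX V V ℂ ^ 0) u r) = if M = 0 ∧ u = r then 1 else 0 := by
  by_cases h : u = r
  · subst h
    simp [coeff_one, eq_comm]
  · simp [h]

theorem coeff_pow_succ (N : ℕ) (M : V × V →₀ ℕ) (u r : V) :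
    coeff M ((Matrix.mvPolynomialX V V ℂ ^ (N + 1)) u r) =
      ∑ j, if M (u, j) = 0 then 0 else
        coeff (M - Finsupp.single (u, j) 1) ((Matrix.mvPolynomialX V V ℂ ^ N) j r) := by
  rw [pow_succ', Matrix.mul_apply, coeff_sum]
  refine sum_congr rfl fun j _ => ?_
  rw [Matrix.mvPolynomialX_apply, coeff_X_mul']
  by_cases h : M (u, j) = 0 <;> simp [h]

theorem exists_eq_add_single {σ : Type*} (M : σ →₀ ℕ) (a : σ) (h : M a ≠ 0) :
    M = (M - Finsupp.single a 1) + Finsupp.single a 1 := by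
  classical
  ext b
  by_cases hb : a = b
  · subst hb
    simp
    omega
  · simp [hb]

/-- The monomials in the entries of powers of the generic matrix are balanced. -/
theorem balanced_of_coeff_ne_zero (N : ℕ) : ∀ (M : V × V →₀ ℕ) (u r : V),
    coeff M ((Matrix.mvPolynomialX V V ℂ ^ N) u r) ≠ 0 → Balanced M u r := by
  induction N with
  | zero =>
    intro M u r h v
    rw [coeff_pow_zero] at h
    obtain ⟨rfl, rfl⟩ := (ite_ne_right_iff.mp h).1
    simp [outdeg, indeg]
  | succ N ih =>
    intro M u r h v
    rw [coeff_pow_succ] at h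
    obtain ⟨j, -, hj⟩ := exists_ne_zero_of_sum_ne_zero h
    obtain ⟨hM, hj⟩ := ite_ne_left_iff.mp hj
    have hb := ih _ _ _ (Ne.symm hj) v
    rw [exists_eq_add_single M (u, j) hM, outdeg_add, indeg_add, outdeg_single, indeg_single]
    omega

/-- A closed walk all of whose arcs are loops stays at one vertex. -/
theorem coeff_pow_of_diagonal (N : ℕ) : ∀ (M : V × V →₀ ℕ) (u r : V),
    (∀ i j, i ≠ j → M (i, j) = 0) →
    coeff M ((Matrix.mvPolynomialX V V ℂ ^ N) u r) =
      if M = Finsupp.single (u, u) N ∧ u = r then 1 else 0 := by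
  induction N with
  | zero => intro M u r _; rw [coeff_pow_zero]; simp
  | succ N ih =>
    intro M u r hM
    rw [coeff_pow_succ, sum_eq_single u (fun j _ hj => if_pos (hM _ _ hj.symm)) (by simp)]
    split_ifs with h1 h2 h2
    · rw [h2.1] at h1
      simp at h1
    · rfl
    · rw [ih, if_pos]
      · exact ⟨by rw [h2.1, Finsupp.single_add]; simp, h2.2⟩
      · intro i j hij
        simp [hM i j hij]
    · rw [ih, if_neg]
      · rintro ⟨h, rfl⟩
        refine h2 ⟨?_, rfl⟩
        rw [exists_eq_add_single M (u, u) h1, h, ← Finsupp.single_add]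
      · intro i j hij
        simp [hM i j hij]

/-- The Laplacian of the arcs `M` with the row of the root `r` replaced by a unit vector; vertices
without outgoing arcs get a unit row as well. -/
def laplacian (M : V × V →₀ ℕ) (r : V) : Matrix V V ℂ := fun i =>
  if i = r then Pi.single r 1
  else Pi.single i ((max (outdeg M i) 1 : ℕ) : ℂ) - fun j => (M (i, j) : ℂ)

/-- The indicator of the vertices with an outgoing arc is a nonzero kernel vector. By balance every
arc ends at such a vertex, so rows other than that of `r` sum to zero against it, and `r` itself is
not such a vertex. -/
theorem det_laplacian_eq_zero (M : V × V →₀ ℕ) (r : V) (hM : Balanced M r r) (h0 : M ≠ 0)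
    (hr : outdeg M r = 0) : (laplacian M r).det = 0 := by
  rw [← Matrix.exists_mulVec_eq_zero_iff]
  refine ⟨fun j => if outdeg M j = 0 then 0 else 1, ?_, ?_⟩
  · intro h
    apply h0
    ext ⟨i, j⟩
    have hi := congrFun h i
    simp only [Pi.zero_apply, ite_eq_left_iff, one_ne_zero, imp_false, not_not] at hi
    simp only [outdeg, sum_eq_zero_iff, mem_univ, true_implies] at hi
    exact hi j
  · ext i
    rw [Matrix.mulVec, dotProduct]
    by_cases hi : i = r
    · subst hi
      refine sum_eq_zero fun j _ => ?_
      by_cases hj : j = i <;> simp [laplacian, hj, hr]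
    · have hcol : ∀ j, (M (i, j) : ℂ) * (if outdeg M j = 0 then 0 else 1) = M (i, j) := by
        intro j
        split_ifs with hj
        · have := hM j
          have hin : indeg M j = 0 := by omega
          simp only [indeg, sum_eq_zero_iff, mem_univ, true_implies] at hin
          simp [hin i]
        · simp
      simp only [laplacian, hi, if_false, Pi.sub_apply, sub_mul, sum_sub_distrib, hcol,
        Pi.single_apply, ite_mul, zero_mul, sum_ite_eq', mem_univ, if_true, Pi.zero_apply]
      rw [← Nat.cast_sum, ← outdeg]
      by_cases ho : outdeg M i = 0
      · simp [ho]
      · rw [Nat.max_eq_left (by omega)]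
        simp [ho]

theorem prod_factorial_add_single {σ : Type*} [Fintype σ] [DecidableEq σ] (M : σ →₀ ℕ) (a : σ) :
    ∏ b, ((M + Finsupp.single a 1 : σ →₀ ℕ) b)! = (M a + 1) * ∏ b, (M b)! := by
  rw [← mul_prod_erase univ _ (mem_univ a), ← mul_prod_erase univ (fun b => (M b)!) (mem_univ a),
    ← mul_assoc]
  congr 1
  · simp [Nat.factorial_succ]
  · refine prod_congr rfl fun b hb => ?_
    simp [(ne_of_mem_erase hb).symm]

/-- An arc `(u, j)` adds `e_u - e_j` to row `u`. The exception is a first arc out of `u`: the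
diagonal entry is already `1` by the `max`, so only `-e_j` is added. -/
theorem laplacian_add_single (M : V × V →₀ ℕ) (u j r : V) (hu : u ≠ r) :
    laplacian M r = (laplacian (M + Finsupp.single (u, j) 1) r).updateRow u
      (laplacian (M + Finsupp.single (u, j) 1) r u + Pi.single j 1 -
        if outdeg M u = 0 then 0 else Pi.single u 1) := by
  ext i l
  by_cases hi : i = u
  · subst hi
    rw [Matrix.updateRow_self]
    simp only [laplacian, hu, if_false, outdeg_add, outdeg_single, if_true, Pi.sub_apply,
      Pi.add_apply, Finsupp.add_apply, Finsupp.single_apply, Prod.mk.injEq, true_and,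
      Pi.single_apply, eq_comm (a := j)]
    by_cases ho : outdeg M i = 0
    · simp only [ho, if_true]
      split_ifs <;> push_cast <;> simp; ring
    · rw [Nat.max_eq_left (by omega), Nat.max_eq_left (by omega)]
      simp only [ho, if_false, Pi.single_apply]
      split_ifs <;> push_cast <;> ring
  · rw [Matrix.updateRow_ne hi]
    have h : ∀ l, (Finsupp.single (u, j) 1 : V × V →₀ ℕ) (i, l) = 0 := fun l => by
      simp [Ne.symm hi]
    simp only [laplacian, outdeg_add, outdeg_single, hi, if_false, Finsupp.add_apply, h, add_zero]

theorem laplacian_add_single_root (M : V × V →₀ ℕ) (j r : V) :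
    laplacian (M + Finsupp.single (r, j) 1) r = laplacian M r := by
  ext i l
  by_cases hi : i = r
  · subst hi
    simp [laplacian]
  · have h : ∀ l, (Finsupp.single (r, j) 1 : V × V →₀ ℕ) (i, l) = 0 := fun l => by
      simp [Ne.symm hi]
    simp only [laplacian, outdeg_add, outdeg_single, hi, if_false, Finsupp.add_apply, h, add_zero]

/-- The determinant is linear in row `u`. Weighted by `M (u, j)`, the corrections `e_j - e_u` sum to
minus row `u`, while the unchanged rows sum to `outdeg M u` times it. -/
theorem sum_mul_det_updateRow_laplacian (M : V × V →₀ ℕ) (u r : V) (hu : u ≠ r)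
    (ho : 1 ≤ outdeg M u) :
    ∑ j, (M (u, j) : ℂ) * ((laplacian M r).updateRow u
      (laplacian M r u + Pi.single j 1 - Pi.single u 1)).det =
      ((outdeg M u : ℂ) - 1) * (laplacian M r).det := by
  simp only [← Matrix.cramer_transpose_apply]
  have hrow : ∑ j, (M (u, j) : ℂ) • (laplacian M r u + Pi.single j (1 : ℂ) - Pi.single u 1) =
      ((outdeg M u : ℂ) - 1) • laplacian M r u := by
    ext l
    simp only [Finset.sum_apply, Pi.smul_apply, Pi.sub_apply, Pi.add_apply, smul_eq_mul, mul_sub, mul_add,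
      sum_sub_distrib, sum_add_distrib, ← sum_mul, ← Nat.cast_sum]
    rw [← outdeg]
    simp only [laplacian, hu, if_false, Nat.max_eq_left ho, Pi.sub_apply, Pi.single_apply,
      mul_ite, mul_one, mul_zero, sum_ite_eq, mem_univ, if_true]
    split_ifs <;> ring
  have hsum := congrArg (fun w => (laplacian M r).transpose.cramer w u) hrow
  simp only [map_sum, map_smul, Finset.sum_apply, Pi.smul_apply, smul_eq_mul] at hsum
  rw [hsum, Matrix.cramer_transpose_apply, Matrix.updateRow_eq_self]

/-- Balance gives `u` in-degree zero, so column `u` vanishes off row `u`. Since `j ≠ u`, replacing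
row `u` by `e_j` makes the whole column vanish, and the added `e_j` does not affect the determinant.
-/
theorem det_updateRow_laplacian_eq (M : V × V →₀ ℕ) (u r j : V) (hu : u ≠ r)
    (hb : Balanced M u r) (ho : outdeg M u = 1) (hj : M (u, j) ≠ 0) :
    ((laplacian M r).updateRow u (laplacian M r u + Pi.single j 1)).det =
      (laplacian M r).det := by
  have hin : indeg M u = 0 := by
    have := hb u
    simp only [hu, if_false, if_true] at this
    omega
  simp only [indeg, sum_eq_zero_iff, mem_univ, true_implies] at hin
  have hju : u ≠ j := by
    rintro rfl
    exact hj (hin u)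
  rw [Matrix.det_updateRow_add, Matrix.updateRow_eq_self, add_eq_left]
  refine Matrix.det_eq_zero_of_column_eq_zero u fun i => ?_
  by_cases hi : i = u
  · subst hi
    simp [hju]
  · rw [Matrix.updateRow_ne hi]
    by_cases hir : i = r
    · simp [laplacian, hir, hu]
    · simp [laplacian, hir, hin i, Ne.symm hi]

/-- Away from the root, truncated subtraction gives out-degrees `0` and `1` the same factor `0!`,
hence the separate value `1`. -/
theorem prod_factorial_outdeg (M : V × V →₀ ℕ) (u j r : V) :
    ∏ i, ((outdeg (M + Finsupp.single (u, j) 1) i - if i = r then 0 else 1)! : ℂ) =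
      (if u = r then (outdeg M u : ℂ) + 1 else if outdeg M u = 0 then 1 else outdeg M u) *
        ∏ i, ((outdeg M i - if i = r then 0 else 1)! : ℂ) := by
  rw [← mul_prod_erase univ _ (mem_univ u),
    ← mul_prod_erase univ (fun i => ((outdeg M i - if i = r then 0 else 1)! : ℂ)) (mem_univ u),
    ← mul_assoc]
  congr 1
  · simp only [outdeg_add, outdeg_single, if_true]
    split_ifs with h1 h2
    · simp [Nat.factorial_succ]
    · simp [h2]
    · obtain ⟨q, hq⟩ := Nat.exists_eq_succ_of_ne_zero h2
      simp [hq, Nat.factorial_succ]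
  · refine prod_congr rfl fun i hi => ?_
    simp [outdeg_add, outdeg_single, ne_of_mem_erase hi]

/-- The number of walks from `u` to `r` with prescribed arc multiplicities `M`, by the
BEST theorem: the coefficient of `M` in the generic matrix power. -/
theorem coeff_pow_mul_prod_factorial (N : ℕ) : ∀ (M : V × V →₀ ℕ) (u r : V),
    ∑ a, M a = N → Balanced M u r →
    coeff M ((Matrix.mvPolynomialX V V ℂ ^ N) u r) * ∏ a, ((M a)! : ℂ) =
      (∏ i, ((outdeg M i - if i = r then 0 else 1)! : ℂ)) * (laplacian M r).det := by
  induction N with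
  | zero =>
    intro M u r hN hb
    obtain rfl : M = 0 := by
      ext a
      simpa using (sum_eq_zero_iff.mp hN) a (mem_univ a)
    have hur : u = r := by
      by_contra h
      have := hb u
      simp [outdeg, indeg, h] at this
    have hL : laplacian (0 : V × V →₀ ℕ) r = 1 := by
      ext i l
      by_cases h : i = r
      · simp [laplacian, h, Matrix.one_apply, Pi.single_apply, eq_comm]
      · simp [laplacian, h, outdeg, Matrix.one_apply, Pi.single_apply, eq_comm]
    rw [coeff_pow_zero, if_pos ⟨rfl, hur⟩, hL]
    simp [outdeg]
  | succ N ih =>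
    intro M u r hN hb
    -- Induction on the first arc `(u, j)`: the rest is a walk from `j` to `r`, and `M!` loses
    -- exactly the factor `M (u, j)`.
    have hterm : ∀ j, ((if M (u, j) = 0 then 0 else coeff (M - Finsupp.single (u, j) 1)
        ((Matrix.mvPolynomialX V V ℂ ^ N) j r)) * ∏ a, ((M a)! : ℂ)) =
        (M (u, j) : ℂ) * ((∏ i, ((outdeg (M - Finsupp.single (u, j) 1) i -
          if i = r then 0 else 1)! : ℂ)) * (laplacian (M - Finsupp.single (u, j) 1) r).det) := by
      intro j
      split_ifs with h
      · simp [h]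
      · have hM := exists_eq_add_single M (u, j) h
        set M' := M - Finsupp.single (u, j) 1
        rw [← ih M' j r]
        · have hf := prod_factorial_add_single M' (u, j)
          rw [← hM] at hf
          rw [← Nat.cast_prod, hf, hM]
          simp only [Finsupp.add_apply, Finsupp.single_eq_same]
          push_cast
          ring
        · rw [hM] at hN
          simp only [Finsupp.add_apply, sum_add_distrib] at hN
          simpa [Finsupp.single_apply] using hN
        · intro v
          have := hb v
          rw [hM, outdeg_add, indeg_add, outdeg_single, indeg_single] at this
          omega
    rw [coeff_pow_succ, sum_mul, sum_congr rfl fun j _ => hterm j]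
    by_cases hu : u = r
    · subst hu
      by_cases ho : outdeg M u = 0
      · rw [det_laplacian_eq_zero M u hb _ ho, mul_zero]
        · refine sum_eq_zero fun j _ => ?_
          simp only [outdeg, sum_eq_zero_iff, mem_univ, true_implies] at ho
          simp [ho j]
        · rintro rfl
          simp at hN
      · have : ∀ j, (M (u, j) : ℂ) * ((∏ i, ((outdeg (M - Finsupp.single (u, j) 1) i -
            if i = u then 0 else 1)! : ℂ)) * (laplacian (M - Finsupp.single (u, j) 1) u).det) =
            (M (u, j) : ℂ) * ((outdeg M u : ℂ)⁻¹ * ((∏ i, ((outdeg M i -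
              if i = u then 0 else 1)! : ℂ)) * (laplacian M u).det)) := by
          intro j
          by_cases h : M (u, j) = 0
          · simp [h]
          have hM := exists_eq_add_single M (u, j) h
          set M' := M - Finsupp.single (u, j) 1
          rw [hM, laplacian_add_single_root, prod_factorial_outdeg, if_pos rfl, outdeg_add,
            outdeg_single, if_pos rfl]
          have : (outdeg M' u : ℂ) + 1 ≠ 0 := Nat.cast_add_one_ne_zero _
          push_cast
          field_simp
        rw [sum_congr rfl fun j _ => this j, ← sum_mul, ← Nat.cast_sum, ← outdeg,
          mul_inv_cancel_left₀ (by exact_mod_cast ho)]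
    · have ho : 1 ≤ outdeg M u := by
        have := hb u
        simp only [hu, if_false, if_true] at this
        omega
      -- With a single outgoing arc its removal turns row `u` into the default unit row; with more,
      -- the factorial of `u` supplies the factor `outdeg M u - 1` that the row sum produces.
      by_cases ho1 : outdeg M u = 1
      · have : ∀ j, (M (u, j) : ℂ) * ((∏ i, ((outdeg (M - Finsupp.single (u, j) 1) i -
            if i = r then 0 else 1)! : ℂ)) * (laplacian (M - Finsupp.single (u, j) 1) r).det) =
            (M (u, j) : ℂ) * ((∏ i, ((outdeg M i - if i = r then 0 else 1)! : ℂ)) *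
              (laplacian M r).det) := by
          intro j
          by_cases h : M (u, j) = 0
          · simp [h]
          have hM := exists_eq_add_single M (u, j) h
          have hdet := det_updateRow_laplacian_eq M u r j hu hb ho1 h
          have hL := laplacian_add_single (M - Finsupp.single (u, j) 1) u j r hu
          have hP := prod_factorial_outdeg (M - Finsupp.single (u, j) 1) u j r
          have ho' : outdeg (M - Finsupp.single (u, j) 1) u = 0 := by
            rw [hM, outdeg_add, outdeg_single, if_pos rfl] at ho1
            omega
          rw [← hM, if_pos ho', sub_zero] at hL
          rw [← hM, if_neg hu, if_pos ho', one_mul] at hP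
          rw [hP, hL, hdet]
        rw [sum_congr rfl fun j _ => this j, ← sum_mul, ← Nat.cast_sum, ← outdeg, ho1]
        simp
      · have hne : (outdeg M u : ℂ) - 1 ≠ 0 := by
          rw [sub_ne_zero]
          exact_mod_cast ho1
        have : ∀ j, (M (u, j) : ℂ) * ((∏ i, ((outdeg (M - Finsupp.single (u, j) 1) i -
            if i = r then 0 else 1)! : ℂ)) * (laplacian (M - Finsupp.single (u, j) 1) r).det) =
            (((outdeg M u : ℂ) - 1)⁻¹ * ∏ i, ((outdeg M i - if i = r then 0 else 1)! : ℂ)) *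
              ((M (u, j) : ℂ) * ((laplacian M r).updateRow u
                (laplacian M r u + Pi.single j 1 - Pi.single u 1)).det) := by
          intro j
          by_cases h : M (u, j) = 0
          · simp [h]
          have hM := exists_eq_add_single M (u, j) h
          have hL := laplacian_add_single (M - Finsupp.single (u, j) 1) u j r hu
          have hP := prod_factorial_outdeg (M - Finsupp.single (u, j) 1) u j r
          have ho' : outdeg M u = outdeg (M - Finsupp.single (u, j) 1) u + 1 := by
            conv_lhs => rw [hM, outdeg_add, outdeg_single, if_pos rfl]
          have ho'' : outdeg (M - Finsupp.single (u, j) 1) u ≠ 0 := by omega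
          rw [← hM, if_neg ho''] at hL
          rw [← hM, if_neg hu, if_neg ho''] at hP
          have hc : (outdeg (M - Finsupp.single (u, j) 1) u : ℂ) = (outdeg M u : ℂ) - 1 := by
            rw [ho']
            push_cast
            ring
          rw [hc] at hP
          rw [hP, hL]
          field_simp
        rw [sum_congr rfl fun j _ => this j, ← mul_sum,
          sum_mul_det_updateRow_laplacian M u r hu ho]
        field_simp

end Walk

/-! ### Closed walks in the complete digraph on an edge. -/

namespace Walk

open MvPolynomial Finset

variable {V : Type*} [DecidableEq V]

/-- The arcs from `i` to the other elements of `e`. -/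
def outStar (e : Finset V) (i : V) : V × V →₀ ℕ := ∑ j ∈ e.erase i, Finsupp.single (i, j) 1

theorem outStar_apply (e : Finset V) (i a b : V) :
    outStar e i (a, b) = if a = i ∧ b ∈ e ∧ b ≠ i then 1 else 0 := by
  simp only [outStar, Finsupp.finsetSum_apply, Finsupp.single_apply, Prod.mk.injEq]
  by_cases h : a = i
  · subst h
    simp [sum_ite_eq', and_comm]
  · simp [h, Ne.symm h]

/-- The arcs of the complete digraph on `e`. -/
def completeArcs (e : Finset V) : V × V →₀ ℕ := ∑ i ∈ e, outStar e i

theorem completeArcs_apply (e : Finset V) (a b : V) :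
    completeArcs e (a, b) = if a ∈ e ∧ b ∈ e ∧ b ≠ a then 1 else 0 := by
  simp only [completeArcs, Finsupp.finsetSum_apply, outStar_apply]
  by_cases h : a ∈ e
  · rw [sum_eq_single a (fun i _ hi => if_neg fun h : _ ∧ _ => hi h.1.symm) (fun h' => absurd h h')]
    simp [h]
  · rw [if_neg fun h' : _ ∧ _ => h h'.1]
    exact sum_eq_zero fun i hi => if_neg (by rintro ⟨rfl, -⟩; exact h hi)

variable [Fintype V]

theorem outdeg_outStar (e : Finset V) (i : V) (hi : i ∈ e) (v : V) :
    outdeg (outStar e i) v = if v = i then #e - 1 else 0 := by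
  simp only [outStar, outdeg_sum, outdeg_single]
  by_cases h : v = i <;> simp [h, card_erase_of_mem hi]

theorem indeg_outStar (e : Finset V) (i v : V) :
    indeg (outStar e i) v = if v ∈ e ∧ v ≠ i then 1 else 0 := by
  simp only [outStar, indeg_sum, indeg_single]
  simp [and_comm]

theorem outdeg_completeArcs (e : Finset V) (v : V) :
    outdeg (completeArcs e) v = if v ∈ e then #e - 1 else 0 := by
  rw [completeArcs, outdeg_sum, sum_congr rfl fun i hi => outdeg_outStar e i hi v]
  simp

theorem indeg_completeArcs (e : Finset V) (v : V) :
    indeg (completeArcs e) v = if v ∈ e then #e - 1 else 0 := by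
  simp only [indeg, completeArcs_apply]
  by_cases h : v ∈ e
  · rw [if_pos h, ← card_erase_of_mem h, card_eq_sum_ones, ← sum_filter]
    refine sum_congr ?_ fun _ _ => rfl
    ext i
    simp [h, and_comm, eq_comm]
  · simp [h]

theorem sum_completeArcs (e : Finset V) : ∑ a, completeArcs e a = #e * (#e - 1) := by
  rw [Fintype.sum_prod_type]
  change ∑ i, outdeg (completeArcs e) i = _
  simp [outdeg_completeArcs]

/-- Rows of `e` other than `r` are `#e • e_i - 1_e`; all others are unit rows. This is a diagonal
matrix times a rank one perturbation of the identity, so the determinant is `#e ^ (#e - 1) * (1 -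
(#e - 1) / #e)`. -/
theorem det_laplacian_completeArcs (e : Finset V) (r : V) (hr : r ∈ e) (he : 2 ≤ #e) :
    (laplacian (completeArcs e) r).det = (#e : ℂ) ^ (#e - 2) := by
  have hk : (#e : ℂ) ≠ 0 := by
    have : #e ≠ 0 := by omega
    exact_mod_cast this
  set c : V → ℂ := fun i => if i ∈ e.erase r then (#e : ℂ) else 1 with hc
  have hL : laplacian (completeArcs e) r = Matrix.diagonal c *
      (1 + Matrix.replicateCol Unit (fun i => if i ∈ e.erase r then -(#e : ℂ)⁻¹ else 0) *
        Matrix.replicateRow Unit (fun j => if j ∈ e then (1 : ℂ) else 0)) := by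
    ext i j
    rw [Matrix.diagonal_mul, Matrix.add_apply, Matrix.mul_apply, Matrix.one_apply]
    simp only [univ_unique, sum_singleton, Matrix.replicateCol_apply, Matrix.replicateRow_apply,
      hc, laplacian, outdeg_completeArcs, mem_erase]
    by_cases hir : i = r
    · simp [hir, Pi.single_apply, eq_comm]
    · by_cases hie : i ∈ e
      · simp only [hir, hie, if_false, ne_eq, not_false_eq_true, true_and, if_true, Pi.sub_apply,
          completeArcs_apply, Pi.single_apply, Nat.max_eq_left (show 1 ≤ #e - 1 by omega)]
        by_cases hij : i = j
        · subst hij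
          simp only [if_true, hie]
          rw [Nat.cast_sub (by omega)]
          field_simp
          simp
          ring
        · by_cases hj : j ∈ e <;> simp [hij, Ne.symm hij, hj, hk]
      · simp [hir, hie, Pi.single_apply, completeArcs_apply, eq_comm]
  rw [hL, Matrix.det_mul, Matrix.det_diagonal, Matrix.det_one_add_replicateCol_mul_replicateRow]
  have h1 : ∏ i, c i = (#e : ℂ) ^ (#e - 1) := by
    simp only [hc, prod_ite_mem, univ_inter, prod_const, card_erase_of_mem hr]
  have h2 : (fun j => if j ∈ e then (1 : ℂ) else 0) ⬝ᵥ
      (fun i => if i ∈ e.erase r then -(#e : ℂ)⁻¹ else 0) = -((#e : ℂ) - 1) * (#e : ℂ)⁻¹ := by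
    have : ∀ i, (if i ∈ e then (1 : ℂ) else 0) * (if i ∈ e.erase r then -(#e : ℂ)⁻¹ else 0) =
        if i ∈ e.erase r then -(#e : ℂ)⁻¹ else 0 := fun i => by
      by_cases hi : i ∈ e.erase r
      · simp [hi, mem_of_mem_erase hi]
      · simp [hi]
    rw [dotProduct, sum_congr rfl fun i _ => this i]
    simp only [sum_ite_mem, univ_inter, sum_const, card_erase_of_mem hr, nsmul_eq_mul]
    rw [Nat.cast_sub (by omega)]
    push_cast
    ring
  rw [h1, h2]
  obtain ⟨q, hq⟩ := Nat.exists_eq_add_of_le he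
  have e1 : #e - 1 = q + 1 := by omega
  have e2 : #e - 2 = q := by omega
  rw [e1, e2, pow_succ]
  field_simp
  ring

theorem prod_factorial_completeArcs (e : Finset V) : ∏ a, ((completeArcs e a)! : ℂ) = 1 := by
  refine prod_eq_one fun a _ => ?_
  rw [← Prod.mk.eta (p := a), completeArcs_apply]
  split_ifs <;> simp

theorem coeff_trace_completeArcs (e : Finset V) (he : 2 ≤ #e) :
    coeff (completeArcs e) (Matrix.trace (Matrix.mvPolynomialX V V ℂ ^ (#e * (#e - 1)))) =
      (#e : ℂ) ^ (#e - 1) * ((#e : ℂ) - 1) * ((#e - 2)! : ℂ) ^ #e := by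
  have hF := prod_factorial_completeArcs e
  have hterm : ∀ r, coeff (completeArcs e)
      ((Matrix.mvPolynomialX V V ℂ ^ (#e * (#e - 1))) r r) =
      if r ∈ e then ((#e - 1)! : ℂ) * ((#e - 2)! : ℂ) ^ (#e - 1) * (#e : ℂ) ^ (#e - 2) else 0 := by
    intro r
    split_ifs with hr
    · have h := coeff_pow_mul_prod_factorial _ (completeArcs e) r r (sum_completeArcs e)
        (fun v => by rw [outdeg_completeArcs, indeg_completeArcs])
      rw [hF, mul_one, det_laplacian_completeArcs e r hr he] at h
      rw [h]
      congr 1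
      rw [← mul_prod_erase univ _ (mem_univ r)]
      congr 1
      · simp [outdeg_completeArcs, hr]
      · rw [← card_erase_of_mem hr, ← prod_const, ← prod_subset (erase_subset_erase r (subset_univ e))]
        · refine prod_congr rfl fun i hi => ?_
          rw [outdeg_completeArcs, if_pos (mem_of_mem_erase hi), if_neg (ne_of_mem_erase hi),
            Nat.sub_sub]
        · intro i hi hi'
          have : i ∉ e := fun h => hi' (mem_erase.mpr ⟨ne_of_mem_erase hi, h⟩)
          simp [outdeg_completeArcs, this]
    -- The walk has positive length, and no arc leaves a vertex outside `e`.
    · obtain ⟨N, hN⟩ : ∃ N, #e * (#e - 1) = N + 1 :=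
        Nat.exists_eq_succ_of_ne_zero (Nat.mul_ne_zero (by omega) (by omega))
      rw [hN, coeff_pow_succ]
      refine sum_eq_zero fun j _ => if_pos ?_
      simp [completeArcs_apply, hr]
  rw [Matrix.trace, coeff_sum]
  simp only [Matrix.diag_apply, hterm, sum_ite_mem, univ_inter, sum_const, nsmul_eq_mul]
  obtain ⟨q, hq⟩ := Nat.exists_eq_add_of_le he
  have e1 : #e - 1 = q + 1 := by omega
  have e2 : #e - 2 = q := by omega
  have e3 : (#e : ℂ) = q + 2 := by
    rw [hq]
    push_cast
    ring
  rw [e1, e2, e3, show #e = q + 2 by omega, Nat.factorial_succ]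
  push_cast
  ring

end Walk

/-! ### Differential operators as adjoints of multiplication. -/

namespace Tensor

open MvPolynomial Finset

variable {σ : Type*} [Fintype σ]

/-- The bilinear form `(p, q) ↦ (p(∂) q)(0)` on polynomials. -/
def pairing : MvPolynomial σ ℂ →ₗ[ℂ] MvPolynomial σ ℂ →ₗ[ℂ] ℂ :=
  (basisMonomials σ ℂ).constr ℂ fun M => (∏ a, ((M a)! : ℂ)) • lcoeff ℂ M

theorem pairing_monomial (M : σ →₀ ℕ) (c : ℂ) (q : MvPolynomial σ ℂ) :
    pairing (monomial M c) q = c * ((∏ a, ((M a)! : ℂ)) * coeff M q) := by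
  have h : monomial M c = c • basisMonomials σ ℂ M := by
    simp [smul_monomial]
  rw [h, map_smul, pairing, Module.Basis.constr_basis]
  simp

theorem pairing_one (q : MvPolynomial σ ℂ) : pairing 1 q = constantCoeff q := by
  rw [show (1 : MvPolynomial σ ℂ) = monomial 0 1 from rfl, pairing_monomial]
  simp [constantCoeff_eq]

/-- The operator `f` is the constant coefficient differential operator `p(∂)`, in the form that
it is adjoint to multiplication by `p`. -/
def IsSymbol (f : Module.End ℂ (MvPolynomial σ ℂ)) (p : MvPolynomial σ ℂ) : Prop :=
  ∀ s q, pairing (p * s) q = pairing s (f q)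

theorem isSymbol_pderiv (a : σ) :
    IsSymbol ((pderiv a : Derivation ℂ (MvPolynomial σ ℂ) (MvPolynomial σ ℂ)) :
      Module.End ℂ (MvPolynomial σ ℂ)) (X a) := by
  classical
  intro s q
  induction s using MvPolynomial.induction_on' with
  | monomial M c =>
    rw [X, monomial_mul, one_mul, pairing_monomial, pairing_monomial, add_comm,
      ← Nat.cast_prod, Walk.prod_factorial_add_single]
    change _ = c * (_ * coeff M (pderiv a q))
    rw [coeff_pderiv]
    push_cast
    ring
  | add p₁ p₂ h₁ h₂ => rw [mul_add, map_add, LinearMap.add_apply, h₁, h₂, map_add]; rfl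

theorem isSymbol_one : IsSymbol (1 : Module.End ℂ (MvPolynomial σ ℂ)) 1 := fun s q => by simp

theorem IsSymbol.mul {f g : Module.End ℂ (MvPolynomial σ ℂ)} {p r : MvPolynomial σ ℂ}
    (hf : IsSymbol f p) (hg : IsSymbol g r) : IsSymbol (f * g) (p * r) := fun s q => by
  -- Adjoints reverse the order of products; commutativity of polynomials restores it.
  rw [mul_comm p, mul_assoc, hg, hf]
  rfl

theorem IsSymbol.smul {f : Module.End ℂ (MvPolynomial σ ℂ)} {p : MvPolynomial σ ℂ} (c : ℂ)
    (hf : IsSymbol f p) : IsSymbol (c • f) (c • p) := fun s q => by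
  rw [smul_mul_assoc, map_smul, LinearMap.smul_apply, hf, LinearMap.smul_apply, map_smul]

theorem IsSymbol.pow {f : Module.End ℂ (MvPolynomial σ ℂ)} {p : MvPolynomial σ ℂ}
    (hf : IsSymbol f p) (n : ℕ) : IsSymbol (f ^ n) (p ^ n) := by
  induction n with
  | zero => simpa using isSymbol_one
  | succ n ih => simpa [pow_succ] using ih.mul hf

theorem isSymbol_sum {ι : Type*} (s : Finset ι) {f : ι → Module.End ℂ (MvPolynomial σ ℂ)}
    {p : ι → MvPolynomial σ ℂ} (h : ∀ i ∈ s, IsSymbol (f i) (p i)) :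
    IsSymbol (∑ i ∈ s, f i) (∑ i ∈ s, p i) := fun t q => by
  rw [sum_mul, map_sum, LinearMap.sum_apply, LinearMap.sum_apply, map_sum]
  exact sum_congr rfl fun i hi => h i hi t q

theorem isSymbol_noncommProd {ι : Type*} (s : Finset ι)
    {f : ι → Module.End ℂ (MvPolynomial σ ℂ)} {p : ι → MvPolynomial σ ℂ}
    (comm : (s : Set ι).Pairwise (Function.onFun Commute f)) (h : ∀ i, IsSymbol (f i) (p i)) :
    IsSymbol (s.noncommProd f comm) (∏ i ∈ s, p i) := by
  classical
  induction s using Finset.induction_on with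
  | empty => simpa using isSymbol_one
  | insert a s ha ih =>
    rw [noncommProd_insert_of_notMem _ _ _ _ ha, prod_insert ha]
    exact (h a).mul (ih _)

theorem isSymbol_prod_ofFn {n : ℕ} {f : Fin n → Module.End ℂ (MvPolynomial σ ℂ)}
    {p : Fin n → MvPolynomial σ ℂ} (h : ∀ i, IsSymbol (f i) (p i)) :
    IsSymbol (List.ofFn f).prod (∏ i, p i) := by
  induction n with
  | zero => simpa using isSymbol_one
  | succ n ih =>
    rw [List.ofFn_succ, List.prod_cons, Fin.prod_univ_succ]
    exact (h 0).mul (ih fun i => h _)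

variable {k : ℕ} {V : Type*} [Fintype V]

/-- The symbol `∑_y t_{iy} a_{i i₂} ⋯ a_{i i_k}` of the differential operator `rowOp T i`. -/
def rowPoly (T : Tensor k V) (i : V) : MvPolynomial (V × V) ℂ :=
  ∑ y : Fin (k - 1) → V, T i y • ∏ j, X (i, y j)

theorem isSymbol_traceOp (T : Tensor k V) (m : V → ℕ) :
    IsSymbol (traceOp T m) (∏ i, (1 / ((m i * (k - 1))! : ℂ)) • rowPoly T i ^ m i) := by
  refine isSymbol_noncommProd _ _ fun i => IsSymbol.smul _ (IsSymbol.pow ?_ _)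
  refine isSymbol_sum _ fun y _ => IsSymbol.smul _ ?_
  exact isSymbol_prod_ofFn fun j => isSymbol_pderiv _

theorem trace_eq_sum_pairing [DecidableEq V] (d : ℕ) (T : Tensor k V) :
    trace d T = ((k : ℂ) - 1) ^ ((Fintype.card V : ℤ) - 1) *
      ∑ m ∈ piAntidiag (univ : Finset V) d, (∏ i, (1 / ((m i * (k - 1))! : ℂ))) *
        pairing (∏ i, rowPoly T i ^ m i)
          (Matrix.trace (Matrix.mvPolynomialX V V ℂ ^ (d * (k - 1)))) := by
  rw [trace, map_sum]
  congr 1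
  refine sum_congr rfl fun m _ => ?_
  rw [← pairing_one, ← isSymbol_traceOp T m, mul_one, Finset.prod_smul, map_smul,
    LinearMap.smul_apply, smul_eq_mul]

end Tensor

/-! ### Row polynomials and the balanced choices of stars. -/

namespace Tensor

open MvPolynomial Finset Walk

/-- A surjection of `Fin m` onto a set of size `m` is a bijection. -/
theorem card_image_eq_filter {V : Type*} [Fintype V] [DecidableEq V] {m : ℕ} (s : Finset V)
    (hs : #s = m) : #{y : Fin m → V | univ.image y = s} = m ! := by
  have hinj : ∀ y : Fin m → V, univ.image y = s → Function.Injective y := fun y hy => by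
    have h : #(univ.image y) = #(univ : Finset (Fin m)) := by simp [hy, hs]
    simpa [Set.injOn_univ] using card_image_iff.mp h
  have hc : Fintype.card (Fin m ≃ s) = m ! := by
    rw [Fintype.card_equiv (Fintype.equivOfCardEq (by simp [hs])), Fintype.card_fin]
  rw [← hc, ← card_univ]
  symm
  refine card_bij (fun w _ j => (w j : V)) ?_ ?_ ?_
  · intro w _
    rw [mem_filter]
    refine ⟨mem_univ _, ?_⟩
    ext v
    simp only [mem_image, mem_univ, true_and]
    constructor
    · rintro ⟨j, rfl⟩
      exact (w j).2
    · intro hv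
      exact ⟨w.symm ⟨v, hv⟩, by simp⟩
  · intro w _ w' _ h
    ext j
    exact congrFun h j
  · intro y hy
    have hy := (mem_filter.mp hy).2
    have hmem : ∀ j, y j ∈ s := fun j => hy ▸ mem_image_of_mem y (mem_univ j)
    refine ⟨Equiv.ofBijective (fun j => ⟨y j, hmem j⟩) ⟨?_, ?_⟩, mem_univ _, rfl⟩
    · intro a b hab
      exact hinj y hy (congrArg Subtype.val hab)
    · rintro ⟨v, hv⟩
      rw [← hy] at hv
      obtain ⟨j, -, rfl⟩ := mem_image.mp hv
      exact ⟨j, rfl⟩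

theorem sum_image_eq {V R : Type*} [Fintype V] [DecidableEq V] [CommSemiring R] {m : ℕ}
    (s : Finset V) (hs : #s = m) (g : V → R) :
    ∑ y : Fin m → V, (if univ.image y = s then ∏ j, g (y j) else 0) =
      (m ! : R) * ∏ x ∈ s, g x := by
  rw [← sum_filter, ← card_image_eq_filter s hs, ← nsmul_eq_mul, ← sum_const]
  refine sum_congr rfl fun y hy => ?_
  have hy := (mem_filter.mp hy).2
  have h : #(univ.image y) = #(univ : Finset (Fin m)) := by simp [hy, hs]
  rw [← hy, prod_image (card_image_iff.mp h)]

variable {k : ℕ} {V : Type*} [DecidableEq V] {E : Finset (Finset V)}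

/-- The arcs of a summand of the symbol of row `i` of a tensor `D + ε A`. -/
def arcs (k : ℕ) (i : V) : Option E → V × V →₀ ℕ
  | none => Finsupp.single (i, i) (k - 1)
  | some e => outStar e.1 i

/-- The coefficient of a summand of the symbol of row `i` of a tensor `D + ε A`. -/
def weight (d : V → ℂ) (ε : ℂ) (i : V) : Option E → ℂ
  | none => d i
  | some e => if i ∈ e.1 then ε else 0

variable [Fintype V]

theorem rowPoly_eq (hE : ∀ e ∈ E, #e = k) (d : V → ℂ) (ε : ℂ) (T : Tensor k V)
    (hT : ∀ i y, T i y = (if ∀ j, y j = i then d i else 0) +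
      ε * (if insert i (univ.image y) ∈ E then 1 / ((k - 1)! : ℂ) else 0)) (i : V) :
    rowPoly T i = ∑ c : Option E, monomial (arcs k i c) (weight d ε i c) := by
  have hdiag : ∑ y : Fin (k - 1) → V, (if ∀ j, y j = i then d i else 0) •
      ∏ j, (X (i, y j) : MvPolynomial (V × V) ℂ) = monomial (Finsupp.single (i, i) (k - 1)) (d i) := by
    rw [sum_eq_single (fun _ => i)]
    · simp [X_pow_eq_monomial, smul_monomial]
    · intro y _ hy
      rw [if_neg fun h => hy (funext h), zero_smul]
    · simp
  have hedge : ∀ e : E, ∑ y : Fin (k - 1) → V, (if insert i (univ.image y) = e.1 then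
      (ε * (1 / ((k - 1)! : ℂ))) • ∏ j, (X (i, y j) : MvPolynomial (V × V) ℂ) else 0) =
      monomial (outStar e.1 i) (if i ∈ e.1 then ε else 0) := by
    rintro ⟨e, he⟩
    dsimp only
    split_ifs with hi
    · have hiff : ∀ y : Fin (k - 1) → V,
          insert i (univ.image y) = e ↔ univ.image y = e.erase i := by
        intro y
        constructor
        · intro h
          symm
          apply eq_of_subset_of_card_le
          · rw [← h]
            intro v hv
            exact (mem_insert.mp (mem_of_mem_erase hv)).resolve_left (ne_of_mem_erase hv)
          · rw [card_erase_of_mem hi, hE e he]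
            exact card_image_le.trans (by simp)
        · intro h
          rw [h, insert_erase hi]
      have hs := sum_image_eq (e.erase i) (by rw [card_erase_of_mem hi, hE e he])
        (fun v => (X (i, v) : MvPolynomial (V × V) ℂ))
      simp only [hiff]
      have hfac : ((k - 1)! : ℂ) ≠ 0 := by exact_mod_cast Nat.factorial_ne_zero _
      have hpull : ∀ y : Fin (k - 1) → V, (if univ.image y = e.erase i then
          (ε * (1 / ((k - 1)! : ℂ))) • ∏ j, (X (i, y j) : MvPolynomial (V × V) ℂ) else 0) =
          (ε * (1 / ((k - 1)! : ℂ))) • if univ.image y = e.erase i then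
            ∏ j, (X (i, y j) : MvPolynomial (V × V) ℂ) else 0 := fun y => by
        split_ifs <;> simp
      rw [sum_congr rfl fun y _ => hpull y, ← smul_sum, hs, outStar, monomial_sum_index,
        ← nsmul_eq_mul, ← Nat.cast_smul_eq_nsmul ℂ, smul_smul, C_mul']
      congr 1
      field_simp
    · rw [map_zero]
      refine sum_eq_zero fun y _ => if_neg ?_
      rintro rfl
      exact hi (mem_insert_self _ _)
  rw [rowPoly, Fintype.sum_option]
  simp only [arcs, weight]
  rw [← hdiag, sum_congr rfl fun e _ => (hedge e).symm, sum_comm, ← sum_add_distrib]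
  refine sum_congr rfl fun y _ => ?_
  rw [hT, add_smul]
  congr 1
  split_ifs with h
  · rw [sum_eq_single ⟨_, h⟩]
    · rw [if_pos rfl]
    · rintro ⟨e, he⟩ _ hne
      rw [if_neg fun h' => hne (Subtype.ext h'.symm)]
    · simp
  · rw [mul_zero, zero_smul]
    symm
    refine sum_eq_zero fun e _ => if_neg fun h' : _ = _ => h (by rw [h']; exact e.2)

/-- At a vertex `v`, let `a` count the stars rooted at `v` and `b` those rooted elsewhere whose edge
contains `v`. Loops cancel, so balance reads `(k - 1) a = b`, that is `k a = a + b ≤ card S ≤ k`. If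
`v` is the root of a star then `a ≥ 1`, so equality holds throughout: there are `k` slots, one star
is rooted at `v`, and every slot holds an edge containing `v`. -/
theorem eq_const_of_balanced (hE : ∀ e ∈ E, #e = k) (hk : 2 ≤ k) {S : Type*} [Fintype S]
    (hS : Fintype.card S ≤ k) (root : S → V) (f : S → Option E)
    (hroot : ∀ s e, f s = some e → root s ∈ e.1)
    (hbal : ∀ v, outdeg (∑ s, arcs k (root s) (f s)) v = indeg (∑ s, arcs k (root s) (f s)) v)
    (hf : ∃ s, f s ≠ none) :
    Fintype.card S = k ∧ ∃ e : E, (∀ s, f s = some e) ∧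
      ∀ v, #{s | root s = v} = if v ∈ e.1 then 1 else 0 := by
  classical
  set a : S → V → ℕ := fun s v => if f s ≠ none ∧ root s = v then 1 else 0 with ha
  set b : S → V → ℕ := fun s v => if (∃ e, f s = some e ∧ v ∈ e.1) ∧ root s ≠ v then 1 else 0
    with hb
  have hab : ∀ s v, a s v + b s v ≤ 1 := fun s v => by
    simp only [ha, hb]
    split_ifs with h1 h2
    · exact absurd h1.2 h2.2
    all_goals omega
  have hsum : ∀ v, k * ∑ s, a s v = ∑ s, (a s v + b s v) := by
    intro v
    have h1 : ∀ s, outdeg (arcs k (root s) (f s)) v + b s v =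
        indeg (arcs k (root s) (f s)) v + (k - 1) * a s v := by
      intro s
      simp only [ha, hb]
      rcases hfs : f s with _ | e
      · simp only [arcs, outdeg_single, indeg_single]
        simp
      · simp only [arcs, outdeg_outStar _ _ (hroot s e hfs), indeg_outStar, hE e.1 e.2]
        by_cases hv : v = root s
        · simp [hv]
        · by_cases hve : v ∈ e.1 <;> simp [hv, Ne.symm hv, hve]
    have h2 := sum_congr (rfl : (univ : Finset S) = univ) fun s _ => h1 s
    have h3 := hbal v
    rw [outdeg_sum, indeg_sum] at h3
    rw [sum_add_distrib, sum_add_distrib, ← mul_sum, h3] at h2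
    rw [sum_add_distrib, Nat.add_left_cancel h2]
    obtain ⟨q, rfl⟩ := Nat.exists_eq_add_of_le hk
    rw [show 2 + q - 1 = q + 1 by omega]
    ring
  have key : ∀ s₁, f s₁ ≠ none → Fintype.card S = k ∧ ∑ s, a s (root s₁) = 1 ∧
      ∀ s, ∃ e, f s = some e ∧ root s₁ ∈ e.1 := by
    intro s₁ hs₁
    have hpos : 1 ≤ ∑ s, a s (root s₁) := by
      have : a s₁ (root s₁) ≤ ∑ s, a s (root s₁) :=
        single_le_sum (f := fun s => a s (root s₁)) (fun _ _ => Nat.zero_le _) (mem_univ s₁)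
      simpa [ha, hs₁] using this
    have hle : ∑ s, (a s (root s₁) + b s (root s₁)) ≤ ∑ _s : S, 1 :=
      sum_le_sum fun s _ => hab s _
    have hcard : ∑ _s : S, 1 = Fintype.card S := by simp
    have h1 := hsum (root s₁)
    have h2 : k * 1 ≤ k * ∑ s, a s (root s₁) := Nat.mul_le_mul_left k hpos
    have h3 : Fintype.card S = k := by omega
    have h4 : ∑ s, a s (root s₁) = 1 := by
      have : k * ∑ s, a s (root s₁) = k * 1 := by omega
      exact Nat.eq_of_mul_eq_mul_left (by omega) this
    refine ⟨h3, h4, fun s => ?_⟩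
    have h5 : ∑ s, (a s (root s₁) + b s (root s₁)) = ∑ _s : S, 1 := by omega
    have h6 := (sum_eq_sum_iff_of_le fun s _ => hab s (root s₁)).mp h5 s (mem_univ s)
    simp only [ha, hb] at h6
    split_ifs at h6 with h7 h8 h8
    · obtain ⟨e, he⟩ := Option.ne_none_iff_exists'.mp h7.1
      exact ⟨e, he, h7.2 ▸ hroot s e he⟩
    · obtain ⟨e, he⟩ := Option.ne_none_iff_exists'.mp h7.1
      exact ⟨e, he, h7.2 ▸ hroot s e he⟩
    · exact h8.1
    · omega
  obtain ⟨s₀, hs₀⟩ := hf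
  have hall : ∀ s, f s ≠ none := fun s => by
    obtain ⟨e, he, -⟩ := (key s₀ hs₀).2.2 s
    simp [he]
  have hcard := (key s₀ hs₀).1
  have hcount : ∀ s, #{s' | root s' = root s} = 1 := fun s => by
    rw [← (key s (hall s)).2.1, card_filter]
    refine sum_congr rfl fun s' _ => ?_
    simp [ha, hall s']
  have hinj : Function.Injective root := fun s s' h =>
    card_le_one.mp (hcount s').le s (by simp [h]) s' (by simp)
  -- Every slot now holds a star, so each chosen edge contains all `k` distinct roots and hence
  -- equals the set of roots.
  have himage : ∀ s e, f s = some e → e.1 = univ.image root := by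
    intro s e he
    symm
    apply eq_of_subset_of_card_le
    · intro v hv
      obtain ⟨s', -, rfl⟩ := mem_image.mp hv
      obtain ⟨e', he', hv'⟩ := (key s' (hall s')).2.2 s
      rw [he] at he'
      exact (Option.some.inj he') ▸ hv'
    · rw [hE e.1 e.2, card_image_of_injective _ hinj, card_univ, hcard]
  obtain ⟨e, he⟩ := Option.ne_none_iff_exists'.mp hs₀
  refine ⟨hcard, e, fun s => ?_, fun v => ?_⟩
  · obtain ⟨e', he'⟩ := Option.ne_none_iff_exists'.mp (hall s)
    rw [he']
    exact congrArg some (Subtype.ext ((himage s e' he').trans (himage s₀ e he).symm))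
  · rw [himage s₀ e he]
    split_ifs with hv
    · obtain ⟨s, -, rfl⟩ := mem_image.mp hv
      exact hcount s
    · rw [card_eq_zero, filter_eq_empty_iff]
      intro s _ hs
      exact hv (hs ▸ mem_image_of_mem root (mem_univ s))

end Tensor

/-! ### Evaluating the surviving terms of the expansion. -/

namespace Tensor

open MvPolynomial Finset Walk

variable {k : ℕ} {V : Type*} [DecidableEq V] {E : Finset (Finset V)} [Fintype V]

theorem sum_sigma_fst {ι β : Type*} [Fintype ι] [AddCommMonoid β] (m : ι → ℕ) (g : ι → β) :
    ∑ s : (Σ i, Fin (m i)), g s.1 = ∑ i, m i • g i := by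
  simp [Fintype.sum_sigma]

theorem prod_sigma_fst {ι β : Type*} [Fintype ι] [CommMonoid β] (m : ι → ℕ) (g : ι → β) :
    ∏ s : (Σ i, Fin (m i)), g s.1 = ∏ i, g i ^ m i := by
  simp [Fintype.prod_sigma]

theorem prod_sum_monomial_pow (d : V → ℂ) (ε : ℂ) (m : V → ℕ) :
    ∏ i, (∑ c : Option E, monomial (arcs k i c) (weight d ε i c)) ^ m i =
      ∑ f : (Σ i, Fin (m i)) → Option E, monomial (∑ s, arcs k s.1 (f s))
        (∏ s, weight d ε s.1 (f s)) := by
  rw [← prod_sigma_fst m fun i => ∑ c : Option E, monomial (arcs k i c) (weight d ε i c),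
    Fintype.prod_sum]
  refine sum_congr rfl fun f _ => ?_
  induction (univ : Finset (Σ i, Fin (m i))) using Finset.induction_on with
  | empty => simp
  | insert a s ha ih => rw [prod_insert ha, sum_insert ha, prod_insert ha, ih, monomial_mul]

/-- The value at the summand `f` of the pairing of `∏_i R_i ^ m_i` with `q`. -/
def summand (k : ℕ) (d : V → ℂ) (ε : ℂ) (q : MvPolynomial (V × V) ℂ) (m : V → ℕ)
    (f : (Σ i, Fin (m i)) → Option E) : ℂ :=
  (∏ s, weight d ε s.1 (f s)) * ((∏ a, (((∑ s, arcs k s.1 (f s)) a)! : ℂ)) *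
    coeff (∑ s, arcs k s.1 (f s)) q)

/-- A closed walk of loops stays at one vertex, so only `m = t • e_v` contributes. There `(t (k -
1))!` from the pairing cancels the normalisation. -/
theorem sum_summand_none (hk : 2 ≤ k) (d : V → ℂ) (ε : ℂ) (t : ℕ) :
    ∑ m ∈ piAntidiag (univ : Finset V) t, (∏ i, (1 / ((m i * (k - 1))! : ℂ))) *
      summand (E := E) k d ε (Matrix.trace (Matrix.mvPolynomialX V V ℂ ^ (t * (k - 1)))) m
        (fun _ => none) = ∑ v, d v ^ t := by
  have hM : ∀ m : V → ℕ, ∑ s : (Σ i, Fin (m i)), arcs (E := E) k s.1 none =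
      ∑ i, Finsupp.single (i, i) (m i * (k - 1)) := fun m => by
    rw [Fintype.sum_sigma]
    refine sum_congr rfl fun i _ => ?_
    simp only [arcs, sum_const, card_univ, Fintype.card_fin, Finsupp.smul_single, smul_eq_mul]
  have hMv : ∀ (m : V → ℕ) (i j : V), (∑ i, Finsupp.single (i, i) (m i * (k - 1)) : V × V →₀ ℕ)
      (i, j) = if i = j then m i * (k - 1) else 0 := fun m i j => by
    simp only [Finsupp.finsetSum_apply, Finsupp.single_apply, Prod.mk.injEq]
    split_ifs with h
    · subst h
      simp
    · refine sum_eq_zero fun l _ => if_neg ?_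
      rintro ⟨rfl, rfl⟩
      exact h rfl
  have hcoeff : ∀ m : V → ℕ, coeff (∑ i, Finsupp.single (i, i) (m i * (k - 1)))
      (Matrix.trace (Matrix.mvPolynomialX V V ℂ ^ (t * (k - 1)))) =
      ∑ v, if m = Pi.single v t then 1 else 0 := fun m => by
    rw [Matrix.trace, coeff_sum]
    refine sum_congr rfl fun v _ => ?_
    rw [Matrix.diag_apply, coeff_pow_of_diagonal _ _ _ _ fun i j hij => by rw [hMv, if_neg hij]]
    refine if_congr ?_ rfl rfl
    simp only [and_true]
    constructor
    · intro h
      ext i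
      have hi := DFunLike.congr_fun h (i, i)
      rw [hMv, if_pos rfl, Finsupp.single_apply] at hi
      have hk' : 0 < k - 1 := by omega
      by_cases hiv : i = v
      · subst hiv
        rw [if_pos rfl] at hi
        simpa using Nat.eq_of_mul_eq_mul_right hk' hi
      · rw [if_neg (by simp [Ne.symm hiv])] at hi
        simpa [hiv, hk'.ne'] using hi
    · rintro rfl
      ext ⟨i, j⟩
      rw [hMv, Finsupp.single_apply]
      by_cases hiv : v = i
      · subst hiv
        simp
      · simp [hiv, Ne.symm hiv]
  simp only [summand, hM, hcoeff, mul_sum]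
  rw [sum_comm]
  refine sum_congr rfl fun v _ => ?_
  have hmem : Pi.single v t ∈ piAntidiag (univ : Finset V) t := by
    rw [mem_piAntidiag]
    simp
  rw [sum_eq_single (Pi.single v t) (fun m _ hm => by rw [if_neg hm]; ring)
    (fun h => absurd hmem h), if_pos rfl]
  have h1 : ∏ i, (1 / (((Pi.single v t : V → ℕ) i * (k - 1))! : ℂ)) = 1 / ((t * (k - 1))! : ℂ) := by
    rw [Fintype.prod_eq_single v fun i hi => by simp [hi]]
    simp
  have h2 : ∏ a, (((∑ i, Finsupp.single (i, i) ((Pi.single v t : V → ℕ) i * (k - 1)) :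
      V × V →₀ ℕ) a)! : ℂ) = ((t * (k - 1))! : ℂ) := by
    rw [Fintype.prod_eq_single (v, v)]
    · rw [hMv]
      simp
    · rintro ⟨i, j⟩ hij
      rw [hMv]
      split_ifs with h
      · subst h
        have : i ≠ v := by
          rintro rfl
          exact hij rfl
        simp [this]
      · simp
  have h3 : ∏ s : (Σ i, Fin ((Pi.single v t : V → ℕ) i)), weight (E := E) d ε s.1 none =
      d v ^ t := by
    rw [Fintype.prod_sigma, Fintype.prod_eq_single v fun i hi => by simp [hi]]
    simp [weight]
  rw [h1, h2, h3]
  have : ((t * (k - 1))! : ℂ) ≠ 0 := by exact_mod_cast Nat.factorial_ne_zero _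
  field_simp

/-- The multiplicity function of the vertices of `e`. -/
def indicator (e : Finset V) : V → ℕ := fun v => if v ∈ e then 1 else 0

theorem eq_of_summand_ne_zero (hE : ∀ e ∈ E, #e = k) (hk : 2 ≤ k) (d : V → ℂ) (ε : ℂ) {t : ℕ}
    (ht : t ≤ k) (N : ℕ) (m : V → ℕ) (hm : ∑ i, m i = t) (f : (Σ i, Fin (m i)) → Option E)
    (hf : f ≠ fun _ => none)
    (h : summand k d ε (Matrix.trace (Matrix.mvPolynomialX V V ℂ ^ N)) m f ≠ 0) :
    t = k ∧ ∃ e : E, m = indicator e.1 ∧ f = fun _ => some e := by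
  have hcard : Fintype.card (Σ i, Fin (m i)) = t := by simp [hm]
  rw [summand] at h
  have hw := left_ne_zero_of_mul h
  have hc := right_ne_zero_of_mul (right_ne_zero_of_mul h)
  rw [Matrix.trace, coeff_sum] at hc
  obtain ⟨r, -, hr⟩ := exists_ne_zero_of_sum_ne_zero hc
  have hb := balanced_of_coeff_ne_zero _ _ _ _ hr
  obtain ⟨h1, e, h2, h3⟩ := eq_const_of_balanced hE hk (hcard.trans_le ht) Sigma.fst f
    (fun s e hs => by
      have := prod_ne_zero_iff.mp hw s (mem_univ s)
      by_contra hne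
      simp [hs, weight, hne] at this)
    (fun v => Nat.add_right_cancel (hb v))
    (by
      by_contra! hn
      exact hf (funext hn))
  refine ⟨hcard.symm.trans h1, e, ?_, funext h2⟩
  ext v
  rw [indicator, ← h3 v, card_filter, sum_sigma_fst m fun i => if i = v then 1 else 0]
  simp

/-- The walk count `k^(k-1) (k-1) (k-2)!^k` is divided by `(k-1)!^k`, which leaves `k^(k-1)
(k-1)^(1-k)`. -/
theorem summand_indicator (hk : 2 ≤ k) (d : V → ℂ) (ε : ℂ) (e : E)
    (he : #e.1 = k) :
    (∏ i, (1 / ((indicator e.1 i * (k - 1))! : ℂ))) *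
      summand k d ε (Matrix.trace (Matrix.mvPolynomialX V V ℂ ^ (k * (k - 1)))) (indicator e.1)
        (fun _ => some e) =
      ε ^ k * ((k : ℂ) ^ (k - 1) * ((k : ℂ) - 1) ^ (1 - (k : ℤ))) := by
  have hM : ∑ s : (Σ i, Fin (indicator e.1 i)), arcs k s.1 (some e) = completeArcs e.1 := by
    rw [sum_sigma_fst _ fun i => arcs k i (some e)]
    simp only [indicator, arcs, ite_smul, one_smul, zero_smul, sum_ite_mem, univ_inter,
      completeArcs]
  have hW : ∏ s : (Σ i, Fin (indicator e.1 i)), weight d ε s.1 (some e) = ε ^ k := by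
    rw [prod_sigma_fst _ fun i => weight d ε i (some e), ← he, ← prod_const,
      ← prod_subset (subset_univ e.1)]
    · refine prod_congr rfl fun i hi => ?_
      simp [indicator, hi, weight]
    · intro i _ hi
      simp [indicator, hi]
  have hP : ∏ i, (1 / ((indicator e.1 i * (k - 1))! : ℂ)) = (1 / ((k - 1)! : ℂ)) ^ k := by
    rw [← he, ← prod_const, ← prod_subset (subset_univ e.1)]
    · refine prod_congr rfl fun i hi => ?_
      simp [indicator, hi]
    · intro i _ hi
      simp [indicator, hi]
  have hC := coeff_trace_completeArcs e.1 (he ▸ hk)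
  rw [he] at hC
  rw [summand, hM, hW, hP, prod_factorial_completeArcs, hC]
  obtain ⟨q, rfl⟩ := Nat.exists_eq_add_of_le hk
  have e1 : 2 + q - 1 = q + 1 := by omega
  have e2 : 2 + q - 2 = q := by omega
  have e3 : ((2 + q : ℕ) : ℂ) - 1 = q + 1 := by
    push_cast
    ring
  have e4 : (1 : ℤ) - ((2 + q : ℕ) : ℤ) = -((q + 1 : ℕ) : ℤ) := by
    push_cast
    ring
  have hq : (q : ℂ) + 1 ≠ 0 := Nat.cast_add_one_ne_zero q
  have hq' : (q ! : ℂ) ≠ 0 := by exact_mod_cast Nat.factorial_ne_zero _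
  rw [e3, e4, zpow_neg, zpow_natCast, e1, e2, Nat.factorial_succ, Nat.cast_mul, Nat.cast_add_one,
    div_pow, mul_pow, show 2 + q = (q + 1) + 1 by ring, one_pow]
  field_simp
  ring

/-- The traces of order at most `k` of a tensor `D + ε A`, where `D` is diagonal and `A` is the
adjacency tensor of a `k`-uniform family `E`. -/
theorem trace_diagonal_add_adjacency (hE : ∀ e ∈ E, #e = k) (hk : 2 ≤ k) (d : V → ℂ) (ε : ℂ)
    (T : Tensor k V)
    (hT : ∀ i y, T i y = (if ∀ j, y j = i then d i else 0) +
      ε * (if insert i (univ.image y) ∈ E then 1 / ((k - 1)! : ℂ) else 0))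
    {t : ℕ} (ht0 : 1 ≤ t) (ht : t ≤ k) :
    trace t T = ((k : ℂ) - 1) ^ ((Fintype.card V : ℤ) - 1) *
      (∑ v, d v ^ t + if t = k then
        #E * (ε ^ k * ((k : ℂ) ^ (k - 1) * ((k : ℂ) - 1) ^ (1 - (k : ℤ)))) else 0) := by
  rw [trace_eq_sum_pairing]
  congr 1
  have hpair : ∀ m ∈ piAntidiag (univ : Finset V) t,
      pairing (∏ i, rowPoly T i ^ m i)
        (Matrix.trace (Matrix.mvPolynomialX V V ℂ ^ (t * (k - 1)))) =
      summand (E := E) k d ε (Matrix.trace (Matrix.mvPolynomialX V V ℂ ^ (t * (k - 1)))) m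
        (fun _ => none) + ∑ e : E, if t = k ∧ m = indicator e.1 then
          summand k d ε (Matrix.trace (Matrix.mvPolynomialX V V ℂ ^ (t * (k - 1)))) m
            (fun _ => some e) else 0 := by
    intro m hm
    have hm' : ∑ i, m i = t := (mem_piAntidiag.mp hm).1
    simp only [rowPoly_eq hE d ε T hT, prod_sum_monomial_pow, map_sum, LinearMap.sum_apply,
      pairing_monomial]
    change ∑ f, summand k d ε _ m f = _
    -- Since `t ≥ 1` there is a slot, so the all-loops choice differs from the all-`e` choice and
    -- nothing is counted twice.
    have hS : Nonempty (Σ i, Fin (m i)) := by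
      rw [← Fintype.card_pos_iff]
      simp only [Fintype.card_sigma, Fintype.card_fin, hm']
      omega
    by_cases hex : t = k ∧ ∃ e : E, m = indicator e.1
    · obtain ⟨htk, e, hme⟩ := hex
      have huniq : ∀ e' : E, m = indicator e'.1 → e' = e := by
        intro e' he'
        ext v
        have := congrFun (he'.symm.trans hme) v
        simp only [indicator] at this
        by_cases h1 : v ∈ e'.1 <;> by_cases h2 : v ∈ e.1 <;> simp_all
      rw [Fintype.sum_eq_add (fun _ => none) (fun _ => some e)]
      · congr 1
        rw [Fintype.sum_eq_single e, if_pos ⟨htk, hme⟩]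
        intro e' he'
        exact if_neg fun h => he' (huniq e' h.2)
      · intro h
        simpa using congrFun h hS.some
      · rintro f ⟨hf0, hfe⟩
        by_contra hne
        obtain ⟨-, e', he', hfe'⟩ := eq_of_summand_ne_zero hE hk d ε ht _ m hm' f hf0 hne
        exact hfe (huniq e' he' ▸ hfe')
    · rw [Fintype.sum_eq_single (fun _ => none), left_eq_add]
      · refine sum_eq_zero fun e _ => if_neg fun h => hex ⟨h.1, e, h.2⟩
      · intro f hf
        by_contra hne
        obtain ⟨htk, e, he, -⟩ := eq_of_summand_ne_zero hE hk d ε ht _ m hm' f hf hne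
        exact hex ⟨htk, e, he⟩
  rw [sum_congr rfl fun m hm => by rw [hpair m hm, mul_add], sum_add_distrib,
    sum_summand_none hk]
  congr 1
  split_ifs with htk
  · subst htk
    simp only [true_and, mul_sum]
    rw [sum_comm]
    have : ∀ e : E, ∑ m ∈ piAntidiag (univ : Finset V) t, (∏ i, (1 / ((m i * (t - 1))! : ℂ))) *
        (if m = indicator e.1 then summand t d ε
          (Matrix.trace (Matrix.mvPolynomialX V V ℂ ^ (t * (t - 1)))) m (fun _ => some e) else 0) =
        ε ^ t * ((t : ℂ) ^ (t - 1) * ((t : ℂ) - 1) ^ (1 - (t : ℤ))) := by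
      intro e
      rw [← summand_indicator hk d ε e (hE e.1 e.2), sum_eq_single (indicator e.1), if_pos rfl]
      · intro m _ hm
        rw [if_neg hm, mul_zero]
      · intro h
        refine absurd ?_ h
        rw [mem_piAntidiag]
        refine ⟨?_, by simp⟩
        change ∑ i, (if i ∈ e.1 then 1 else 0) = t
        simp [hE e.1 e.2]
    rw [sum_congr rfl fun e _ => this e]
    simp
  · simp [htk]

end Tensor

/-! ### Transfer to the tensors of a hypergraph. -/

namespace Hypergraph

open Finset

variable {α : Type*} (H : Hypergraph α) [Fintype H.vertexSet]

open Classical in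
/-- The edges as finite sets of vertices. -/
def edgeFinset : Finset (Finset H.vertexSet) :=
  {s | Subtype.val '' (s : Set H.vertexSet) ∈ H.edgeSet}

theorem mem_edgeFinset (s : Finset H.vertexSet) :
    s ∈ H.edgeFinset ↔ Subtype.val '' (s : Set H.vertexSet) ∈ H.edgeSet := by
  simp [edgeFinset]

theorem card_of_mem_edgeFinset {k : ℕ} (hH : H.IsUniform k) (s : Finset H.vertexSet)
    (hs : s ∈ H.edgeFinset) : #s = k := by
  rw [← (hH _ ((H.mem_edgeFinset s).mp hs)).2, Set.ncard_image_of_injective _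
    Subtype.val_injective, Set.ncard_coe_finset]

theorem card_edgeFinset : #H.edgeFinset = H.edgeSet.ncard := by
  classical
  rw [← Set.ncard_coe_finset]
  refine Set.ncard_congr (fun s _ => Subtype.val '' (s : Set H.vertexSet)) ?_ ?_ ?_
  · intro s hs
    exact (H.mem_edgeFinset s).mp hs
  · intro s s' _ _ h
    exact coe_injective (Subtype.val_injective.image_injective h)
  · intro e he
    have hsub : Subtype.val '' (Subtype.val ⁻¹' e : Set H.vertexSet) = e := by
      rw [Subtype.image_preimage_coe, Set.inter_eq_right]
      exact H.subset_vertexSet_of_mem_edgeSet' he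
    refine ⟨(Subtype.val ⁻¹' e : Set H.vertexSet).toFinset, ?_, ?_⟩
    · rw [mem_coe, mem_edgeFinset, Set.coe_toFinset, hsub]
      exact he
    · rw [Set.coe_toFinset, hsub]

theorem degTensor_add_smul_adjTensor_apply [DecidableEq H.vertexSet] {k : ℕ} (ε : ℂ)
    (i : H.vertexSet) (y : Fin (k - 1) → H.vertexSet) :
    (H.degTensor k + ε • H.adjTensor k) i y = (if ∀ j, y j = i then (H.degree i : ℂ) else 0) +
      ε * (if insert i (univ.image y) ∈ H.edgeFinset then 1 / ((k - 1)! : ℂ) else 0) := by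
  have h : Subtype.val '' ((insert i (univ.image y) : Finset H.vertexSet) : Set H.vertexSet) =
      insert (i : α) (Set.range fun j => (y j : α)) := by
    rw [coe_insert, Set.image_insert_eq, coe_image, coe_univ, Set.image_univ, ← Set.range_comp]
    rfl
  simp only [Pi.add_apply, Pi.smul_apply, smul_eq_mul, degTensor, adjTensor]
  congr 1
  · congr
  · have hiff := H.mem_edgeFinset (insert i (univ.image y))
    rw [h] at hiff
    congr 1
    split_ifs with h1 h2 h2
    · rfl
    · exact absurd (hiff.mpr h1) h2
    · exact absurd (hiff.mp h2) h1
    · rfl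

theorem trace_degTensor_add_smul_adjTensor [DecidableEq H.vertexSet] {k : ℕ} (hk : 2 ≤ k)
    (hH : H.IsUniform k) (ε : ℂ) {t : ℕ} (ht0 : 1 ≤ t) (ht : t ≤ k) :
    Tensor.trace t (H.degTensor k + ε • H.adjTensor k) =
      ((k : ℂ) - 1) ^ ((Fintype.card H.vertexSet : ℤ) - 1) * (∑ v : H.vertexSet, (H.degree v : ℂ) ^ t +
        if t = k then H.edgeSet.ncard *
          (ε ^ k * ((k : ℂ) ^ (k - 1) * ((k : ℂ) - 1) ^ (1 - (k : ℤ)))) else 0) := by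
  rw [← H.card_edgeFinset]
  exact Tensor.trace_diagonal_add_adjacency (H.card_of_mem_edgeFinset hH) hk
    (fun v => (H.degree v : ℂ)) ε _ (H.degTensor_add_smul_adjTensor_apply ε) ht0 ht

theorem trace_top_degTensor_add_smul_adjTensor [DecidableEq H.vertexSet] {k : ℕ} (hk : 2 ≤ k)
    (hH : H.IsUniform k) (ε : ℂ) :
    Tensor.trace k (H.degTensor k + ε • H.adjTensor k) =
      ε ^ k * (k : ℂ) ^ (k - 1) * ((k : ℂ) - 1) ^ ((Fintype.card H.vertexSet : ℤ) - (k : ℤ)) *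
          (H.edgeSet.ncard : ℂ) +
        ((k : ℂ) - 1) ^ ((Fintype.card H.vertexSet : ℤ) - 1) *
          ∑ v : H.vertexSet, (H.degree v : ℂ) ^ k := by
  have hk1 : (k : ℂ) - 1 ≠ 0 := by
    rw [sub_ne_zero]
    have : k ≠ 1 := by omega
    exact_mod_cast this
  -- Integer exponents are split using `k - 1 ≠ 0`, since `n - k` may be negative.
  rw [H.trace_degTensor_add_smul_adjTensor hk hH ε (by omega) le_rfl, if_pos rfl,
    show (Fintype.card H.vertexSet : ℤ) - (k : ℤ) =
      ((Fintype.card H.vertexSet : ℤ) - 1) + (1 - (k : ℤ)) by ring, zpow_add₀ hk1]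
  ring

end Hypergraph

end

theorem theorem2p3 {α : Type*} [DecidableEq α] (H : Hypergraph α) [Fintype H.vertexSet]
    (k n : ℕ) (hk : 2 ≤ k) (hn : Fintype.card H.vertexSet = n) (hH : H.IsUniform k) :
    (∀ t : ℕ, 1 ≤ t → t ≤ k - 1 →
      Tensor.trace t (H.laplacianTensor k) =
          ((k : ℂ) - 1) ^ ((n : ℤ) - 1) * ∑ v : H.vertexSet, (H.degree v : ℂ) ^ t ∧
      Tensor.trace t (H.signlessLaplacianTensor k) =
          ((k : ℂ) - 1) ^ ((n : ℤ) - 1) * ∑ v : H.vertexSet, (H.degree v : ℂ) ^ t) ∧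
    Tensor.trace k (H.laplacianTensor k) =
      (-1) ^ k * (k : ℂ) ^ (k - 1) * ((k : ℂ) - 1) ^ ((n : ℤ) - (k : ℤ)) * (H.edgeSet.ncard : ℂ) +
        ((k : ℂ) - 1) ^ ((n : ℤ) - 1) * ∑ v : H.vertexSet, (H.degree v : ℂ) ^ k ∧
    Tensor.trace k (H.signlessLaplacianTensor k) =
      (k : ℂ) ^ (k - 1) * ((k : ℂ) - 1) ^ ((n : ℤ) - (k : ℤ)) * (H.edgeSet.ncard : ℂ) +
        ((k : ℂ) - 1) ^ ((n : ℤ) - 1) * ∑ v : H.vertexSet, (H.degree v : ℂ) ^ k := by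
  subst hn
  have hL : H.laplacianTensor k = H.degTensor k + (-1 : ℂ) • H.adjTensor k := by
    rw [Hypergraph.laplacianTensor, neg_one_smul, sub_eq_add_neg]
  have hQ : H.signlessLaplacianTensor k = H.degTensor k + (1 : ℂ) • H.adjTensor k := by
    rw [Hypergraph.signlessLaplacianTensor, one_smul]
  rw [hL, hQ]
  refine ⟨fun t ht0 ht => ⟨?_, ?_⟩, H.trace_top_degTensor_add_smul_adjTensor hk hH (-1), ?_⟩
  · rw [H.trace_degTensor_add_smul_adjTensor hk hH _ ht0 (by omega), if_neg (by omega), add_zero]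
  · rw [H.trace_degTensor_add_smul_adjTensor hk hH _ ht0 (by omega), if_neg (by omega), add_zero]
  · rw [H.trace_top_degTensor_add_smul_adjTensor hk hH 1, one_pow, one_mul]
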